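/- Let $K$ be an algebraically closed field of arbitrary characteristic, and let $A=(A_1,\dots,A_m)$ and $B=(B_1,\dots,B_m)$ be $m$-tuples of $n\times n$ matrices over $K$. The group $\mathrm{GL}_n(K)$ acts on $\mathrm{Mat}_{n,n}^m$ by simultaneous conjugation, $g\cdot(X_1,\dots,X_m)=(gX_1g^{-1},\dots,gX_mg^{-1})$. Write $A\sim_C B$ if the Zariski closures in $\mathrm{Mat}_{n,n}^m$ of the orbits of $A$ and $B$ intersect: $\overline{\mathrm{GL}_n(K)\cdot A}\cap\overline{\mathrm{GL}_n(K)\cdot B}\neq\emptyset$. Put $C_i=\begin{pmatrix}A_i&0\\0&B_i\end{pmatrix}$ for $1\le i\le m$, and let $\mathcal C\subseteq\mathrm{Mat}_{2n,2n}$ be the unital subalgebra generated by $C_1,\dots,C_m$. For a word $w=i_1i_2\cdots i_b$ in the alphabet $\{1,\dots,m\}$ let $C_w=C_{i_1}C_{i_2}\cdots C_{i_b}$, with $C_\epsilon=\mathrm{Id}$ for the empty word $\epsilon$. Order words by length first, and words of the same length lexicographically. A word $w$ is called a pivot if $C_w$ does not lie in the linear span of all $C_u$ with $u$ smaller than $w$.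 The matrices $C_w$, $w$ a pivot, form a basis of $\mathcal C$, called the pivot basis; denote its members by $Z_1,\dots,Z_s$ and write $Z_j=\begin{pmatrix}X_j&0\\0&Y_j\end{pmatrix}$ with $X_j,Y_j\in\mathrm{Mat}_{n,n}$. Then $A\sim_C B$ if and only if $\det(\mathrm{Id}+tX_j)=\det(\mathrm{Id}+tY_j)$ as polynomials in $t$ for all $j=1,\dots,s$. -/

import Mathlib

open scoped Polynomial

noncomputable section

namespace MatrixInvariants

/-! ### Closure equivalence for simultaneous conjugation -/

/-- The list of all matrix entries of a tuple `A ∈ Mat_{n,n}^m`, as a point of the affine space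
`K ^ (m * n * n)`. -/
def coords {K : Type*} {m n : ℕ} (A : Fin m → Matrix (Fin n) (Fin n) K) :
    Fin m × Fin n × Fin n → K :=
  fun q => A q.1 q.2.1 q.2.2

/-- Zariski closure in the vector space `Mat_{n,n}^m`: the common zeros of all polynomials in the
matrix entries that vanish on `S`. -/
def zariskiClosure {K : Type*} [Field K] {m n : ℕ}
    (S : Set (Fin m → Matrix (Fin n) (Fin n) K)) : Set (Fin m → Matrix (Fin n) (Fin n) K) :=
  {A | coords A ∈ MvPolynomial.zeroLocus K (MvPolynomial.vanishingIdeal K (coords '' S))}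

/-- The orbit of `A` under `g • (A₁, …, Aₘ) = (g A₁ g⁻¹, …, g Aₘ g⁻¹)`, `g ∈ GL_n(K)`. -/
def conjOrbit {K : Type*} [Field K] {m n : ℕ} (A : Fin m → Matrix (Fin n) (Fin n) K) :
    Set (Fin m → Matrix (Fin n) (Fin n) K) :=
  Set.range fun (g : GL (Fin n) K) (i : Fin m) =>
    (g : Matrix (Fin n) (Fin n) K) * A i * ((g⁻¹ : GL (Fin n) K) : Matrix (Fin n) (Fin n) K)

/-- `A ∼_C B`: the Zariski closures of the two conjugation orbits intersect. -/
def ClosureEquiv {K : Type*} [Field K] {m n : ℕ} (A B : Fin m → Matrix (Fin n) (Fin n) K) :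
    Prop :=
  (zariskiClosure (conjOrbit A) ∩ zariskiClosure (conjOrbit B)).Nonempty

/-! ### Pivot words and the pivot basis -/

section Pivot

variable {K : Type*} [Field K] {ι : Type*} [Fintype ι] [DecidableEq ι] {m : ℕ}

/-- `C_w = C_{i₁} C_{i₂} ⋯ C_{i_b}` for a word `w = i₁ i₂ … i_b`; the empty word gives `1`. -/
def wordProd (C : Fin m → Matrix ι ι K) (w : List (Fin m)) : Matrix ι ι K :=
  (w.map C).prod

/-- A word `w` is a pivot if `C_w` is not in the span of all `C_u`, where `u` is smaller than `w`:
shorter words come first, and words of equal length are ordered lexicographically. -/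
def IsPivot (C : Fin m → Matrix ι ι K) (w : List (Fin m)) : Prop :=
  wordProd C w ∉ Submodule.span K (wordProd C '' {u | List.Shortlex (· < ·) u w})

/-- The unital subalgebra generated by `C₁, …, Cₘ`. -/
abbrev genAlgebra (C : Fin m → Matrix ι ι K) : Subalgebra K (Matrix ι ι K) :=
  Algebra.adjoin K (Set.range C)

theorem wordProd_mem (C : Fin m → Matrix ι ι K) (w : List (Fin m)) :
    wordProd C w ∈ genAlgebra C := by
  refine Subalgebra.list_prod_mem _ fun x hx => ?_
  obtain ⟨i, -, rfl⟩ := List.mem_map.1 hx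
  exact Algebra.subset_adjoin ⟨i, rfl⟩

theorem wordProd_mem_span_pivots (C : Fin m → Matrix ι ι K) (w : List (Fin m)) :
    wordProd C w ∈ Submodule.span K (wordProd C '' {u | IsPivot C u}) := by
  induction w using (List.Shortlex.wf (r := fun a b : Fin m => a < b) wellFounded_lt).induction with
  | _ w ih =>
    by_cases hw : IsPivot C w
    · exact Submodule.subset_span ⟨w, hw, rfl⟩
    · refine Submodule.span_le.2 ?_ (not_not.1 hw)
      rintro _ ⟨u, hu, rfl⟩
      exact ih u hu

theorem genAlgebra_le_span (C : Fin m → Matrix ι ι K) :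
    Subalgebra.toSubmodule (genAlgebra C) ≤
      Submodule.span K (wordProd C '' {u | IsPivot C u}) := by
  rw [Algebra.adjoin_eq_span, Submodule.span_le]
  intro x hx
  rw [← FreeMonoid.mrange_lift] at hx
  obtain ⟨w, rfl⟩ := hx
  rw [FreeMonoid.lift_apply]
  exact wordProd_mem_span_pivots C w.toList

theorem linearIndependent_pivots (C : Fin m → Matrix ι ι K) :
    LinearIndependent K fun w : {w : List (Fin m) // IsPivot C w} => wordProd C w.1 := by
  classical
  rw [linearIndependent_iff']
  intro s g hg
  by_contra! hne
  obtain ⟨i₀, hi₀, hgi₀⟩ := hne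
  obtain ⟨w, hw, hmax⟩ : ∃ w ∈ s.filter (fun i => g i ≠ 0), ∀ u ∈ s.filter (fun i => g i ≠ 0),
      u ≠ w → List.Shortlex (· < ·) u.1 w.1 := by
    obtain ⟨w, hw, h⟩ := Finset.exists_max_image (s.filter (fun i => g i ≠ 0))
      (fun i => toLex (i.1.length, i.1)) ⟨i₀, by simp [hi₀, hgi₀]⟩
    refine ⟨w, hw, fun u hu hne => ?_⟩
    have h1 := lt_of_le_of_ne (h u hu) (fun e => hne (Subtype.ext (congrArg Prod.snd (toLex.injective e))))
    rw [Prod.Lex.toLex_lt_toLex] at h1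
    exact List.shortlex_def.2 h1
  rw [Finset.mem_filter] at hw
  refine w.2 ?_
  have h2 : wordProd C w.1 = ∑ i ∈ s.erase w, (-(g w)⁻¹ * g i) • wordProd C i.1 := by
    rw [← Finset.add_sum_erase s _ hw.1] at hg
    simp only [mul_smul, ← Finset.smul_sum]
    rw [eq_neg_of_add_eq_zero_right hg]
    simp [smul_smul, hw.2]
  rw [h2]
  refine Submodule.sum_mem _ fun i hi => ?_
  rw [Finset.mem_erase] at hi
  by_cases h0 : g i = 0
  · simp [h0]
  · exact Submodule.smul_mem _ _ (Submodule.subset_span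
      ⟨i.1, hmax i (by simp [hi.2, h0]) hi.1, rfl⟩)

/-- The pivot basis of the algebra generated by `C₁, …, Cₘ`: its members are the `C_w`, where `w`
runs over the pivots. -/
def pivotBasis (C : Fin m → Matrix ι ι K) :
    Module.Basis {w : List (Fin m) // IsPivot C w} K (genAlgebra C) :=
  Module.Basis.mk (v := fun w => ⟨wordProd C w.1, wordProd_mem C w.1⟩)
    (LinearIndependent.of_comp (genAlgebra C).val.toLinearMap (linearIndependent_pivots C))
    (by
      rintro ⟨x, hx⟩ -
      have h := genAlgebra_le_span C hx
      rw [← Submodule.apply_mem_span_image_iff_mem_span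
        (f := (genAlgebra C).val.toLinearMap) Subtype.val_injective, ← Set.range_comp]
      refine Submodule.span_mono ?_ h
      rintro _ ⟨w, hw, rfl⟩
      exact ⟨⟨w, hw⟩, rfl⟩)

theorem coe_pivotBasis (C : Fin m → Matrix ι ι K) (w : {w : List (Fin m) // IsPivot C w}) :
    (pivotBasis C w : Matrix ι ι K) = wordProd C w.1 := by
  simp [pivotBasis]

end Pivot

/-! ### The block-diagonal tuple and the characteristic polynomial -/

/-- `C_i = diag(A_i, B_i)`. -/
def blockDiag {K : Type*} [Field K] {m n : ℕ} (A B : Fin m → Matrix (Fin n) (Fin n) K) :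
    Fin m → Matrix (Fin n ⊕ Fin n) (Fin n ⊕ Fin n) K :=
  fun i => Matrix.fromBlocks (A i) 0 0 (B i)

theorem wordProd_blockDiag {K : Type*} [Field K] {m n : ℕ}
    (A B : Fin m → Matrix (Fin n) (Fin n) K) (w : List (Fin m)) :
    wordProd (blockDiag A B) w = Matrix.fromBlocks (wordProd A w) 0 0 (wordProd B w) := by
  induction w with
  | nil => simp [wordProd]
  | cons i w ih =>
    simp only [wordProd, List.map_cons, List.prod_cons] at ih ⊢
    rw [ih]
    simp [blockDiag, Matrix.fromBlocks_multiply]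

/-- Members of the pivot basis of the algebra generated by the `diag(A_i, B_i)` are
block diagonal, so they are determined by their two diagonal blocks. -/
theorem pivotBasis_eq_fromBlocks {K : Type*} [Field K] {m n : ℕ}
    (A B : Fin m → Matrix (Fin n) (Fin n) K)
    (j : {w : List (Fin m) // IsPivot (blockDiag A B) w}) :
    (pivotBasis (blockDiag A B) j : Matrix (Fin n ⊕ Fin n) (Fin n ⊕ Fin n) K) =
      Matrix.fromBlocks
        (pivotBasis (blockDiag A B) j : Matrix (Fin n ⊕ Fin n) (Fin n ⊕ Fin n) K).toBlocks₁₁ 0 0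
        (pivotBasis (blockDiag A B) j : Matrix (Fin n ⊕ Fin n) (Fin n ⊕ Fin n) K).toBlocks₂₂ := by
  rw [coe_pivotBasis, wordProd_blockDiag]
  simp

/-- The polynomial `det(Id + t X)` in the indeterminate `t`. -/
def detOneAddT {K : Type*} [Field K] {n : ℕ} (X : Matrix (Fin n) (Fin n) K) : K[X] :=
  (1 + (Polynomial.X : K[X]) • X.map Polynomial.C).det

end MatrixInvariants

end

/-! The coefficients of `det(1 + t x(A))`, for `x` a noncommutative polynomial, are polynomial
conjugation invariants, so they are constant on orbit closures. This gives one direction, for every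
word.

For the converse, choose `D`, `E` in the two closures for which the algebra `R` generated by the
pairs `(D_i, E_i)` has least dimension. A non-semisimple `R` would contain a nonzero square-zero
left ideal `I`; degenerating along the invariant subspaces spanned by the images of `I` kills `I`
and keeps all relations, so the dimension would drop (`exists_semisimple_degeneration`). Relations
and determinants both pass to closures, hence the pivot words of `(A, B)` span `R` and have equal
determinants at `D` and `E`.

Over an algebraically closed field `R` is a product of matrix algebras, and a representation with
multiplicities `N_i` has `det(1 + t z) = ∏ det(1 + t z_i) ^ N_i` (`exists_conj_blockDiagonal`). The
determinant is not linear in `z`, so equality on a spanning set does not extend directly. Its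
`t`-coefficient `∑ N_i tr z_i` is linear and determines the `N_i` in `K`; in characteristic `p` the
full polynomials recover them by cancelling common factors and taking `p`-th roots
(`exponents_eq_of_prod_pow_eq`). Equal multiplicities make `E` conjugate to `D`, so `E` lies in both
closures. -/

noncomputable section

namespace MatrixInvariants

/-! ### Orbit closures, invariants and one-parameter degenerations -/

section Closure

variable {K : Type*} [Field K] {m n : ℕ}

theorem mem_zariskiClosure_iff {S : Set (Fin m → Matrix (Fin n) (Fin n) K)}
    {A : Fin m → Matrix (Fin n) (Fin n) K} :
    A ∈ zariskiClosure S ↔ ∀ f : MvPolynomial (Fin m × Fin n × Fin n) K,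
      (∀ B ∈ S, MvPolynomial.aeval (coords B) f = 0) → MvPolynomial.aeval (coords A) f = 0 := by
  simp [zariskiClosure, MvPolynomial.mem_zeroLocus_iff, MvPolynomial.mem_vanishingIdeal_iff]

theorem subset_zariskiClosure (S : Set (Fin m → Matrix (Fin n) (Fin n) K)) :
    S ⊆ zariskiClosure S :=
  fun A hA => mem_zariskiClosure_iff.2 fun _ h => h A hA

/-- The tuple of generic matrices, whose entries are independent variables. -/
def genericTuple (K : Type*) [Field K] (m n : ℕ) (i : Fin m) :
    Matrix (Fin n) (Fin n) (MvPolynomial (Fin m × Fin n × Fin n) K) :=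
  Matrix.of fun a b => MvPolynomial.X (i, a, b)

theorem genericTuple_map (A : Fin m → Matrix (Fin n) (Fin n) K) (i : Fin m) :
    (genericTuple K m n i).map (MvPolynomial.aeval (coords A)) = A i := by
  ext a b
  simp [genericTuple, coords]

/-- The value of a noncommutative polynomial at a tuple of matrices. -/
abbrev evalTuple {S : Type*} [CommRing S] [Algebra K S] (A : Fin m → Matrix (Fin n) (Fin n) S) :
    FreeAlgebra K (Fin m) →ₐ[K] Matrix (Fin n) (Fin n) S :=
  FreeAlgebra.lift K A

theorem evalTuple_genericTuple_map (A : Fin m → Matrix (Fin n) (Fin n) K)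
    (x : FreeAlgebra K (Fin m)) :
    (evalTuple (genericTuple K m n) x).map (MvPolynomial.aeval (coords A)) = evalTuple A x := by
  have h : ((MvPolynomial.aeval (coords A)).mapMatrix : _ →ₐ[K] Matrix (Fin n) (Fin n) K).comp
      (evalTuple (genericTuple K m n)) = evalTuple A := by
    ext i : 2
    simpa using genericTuple_map A i
  exact DFunLike.congr_fun h x

/-- A polynomial map sending `S` into the closure of `T` sends the closure of `S` there, too. -/
theorem map_mem_zariskiClosure {S T : Set (Fin m → Matrix (Fin n) (Fin n) K)}
    (Φ : Fin m → Matrix (Fin n) (Fin n) (MvPolynomial (Fin m × Fin n × Fin n) K))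
    (h : ∀ A ∈ S, (fun i => (Φ i).map (MvPolynomial.aeval (coords A))) ∈ zariskiClosure T)
    {A : Fin m → Matrix (Fin n) (Fin n) K} (hA : A ∈ zariskiClosure S) :
    (fun i => (Φ i).map (MvPolynomial.aeval (coords A))) ∈ zariskiClosure T := by
  have key : ∀ (B : Fin m → Matrix (Fin n) (Fin n) K) (f : MvPolynomial _ K),
      MvPolynomial.aeval (coords fun i => (Φ i).map (MvPolynomial.aeval (coords B))) f =
      MvPolynomial.aeval (coords B) (MvPolynomial.aeval (fun q => Φ q.1 q.2.1 q.2.2) f) := by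
    intro B f
    rw [← AlgHom.comp_apply, MvPolynomial.comp_aeval]
    rfl
  rw [mem_zariskiClosure_iff] at hA ⊢
  intro f hf
  rw [key]
  refine hA _ fun B hB => ?_
  rw [← key]
  exact mem_zariskiClosure_iff.1 (h B hB) f hf

theorem conj_mem_conjOrbit {A D : Fin m → Matrix (Fin n) (Fin n) K} (hD : D ∈ conjOrbit A)
    {g h : Matrix (Fin n) (Fin n) K} (hgh : g * h = 1) :
    (fun i => g * D i * h) ∈ conjOrbit A := by
  obtain ⟨u, rfl⟩ := hD
  refine ⟨⟨g, h, hgh, mul_eq_one_comm.1 hgh⟩ * u, ?_⟩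
  funext i
  simp [Units.val_mul, mul_assoc, Units.inv_mk]

/-- Conjugation by a fixed matrix is a polynomial map preserving the orbit. -/
theorem conj_mem_zariskiClosure {A D : Fin m → Matrix (Fin n) (Fin n) K}
    (hD : D ∈ zariskiClosure (conjOrbit A)) {g h : Matrix (Fin n) (Fin n) K} (hgh : g * h = 1) :
    (fun i => g * D i * h) ∈ zariskiClosure (conjOrbit A) := by
  have key : ∀ B : Fin m → Matrix (Fin n) (Fin n) K, (fun i => (g.map MvPolynomial.C *
      genericTuple K m n i * h.map MvPolynomial.C).map (MvPolynomial.aeval (coords B))) =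
      fun i => g * B i * h := by
    intro B
    funext i
    have := genericTuple_map B i
    rw [Matrix.map_mul, Matrix.map_mul, this]
    congr 2 <;> ext <;> simp
  rw [← key]
  refine map_mem_zariskiClosure _ (fun B hB => ?_) hD
  rw [key]
  exact subset_zariskiClosure _ (conj_mem_conjOrbit hB hgh)

/-- A polynomial function that is constant on an orbit is constant on its closure. -/
theorem aeval_eq_of_mem_closure {A D : Fin m → Matrix (Fin n) (Fin n) K}
    (hD : D ∈ zariskiClosure (conjOrbit A)) (f : MvPolynomial (Fin m × Fin n × Fin n) K)
    (hf : ∀ B ∈ conjOrbit A, MvPolynomial.aeval (coords B) f = MvPolynomial.aeval (coords A) f) :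
    MvPolynomial.aeval (coords D) f = MvPolynomial.aeval (coords A) f := by
  have := mem_zariskiClosure_iff.1 hD (f - MvPolynomial.C (MvPolynomial.aeval (coords A) f))
    fun B hB => by rw [map_sub, hf B hB]; simp
  simpa [sub_eq_zero] using this

theorem evalTuple_conj (A : Fin m → Matrix (Fin n) (Fin n) K) {g h : Matrix (Fin n) (Fin n) K}
    (hgh : g * h = 1) (x : FreeAlgebra K (Fin m)) :
    evalTuple (fun i => g * A i * h) x = g * evalTuple A x * h := by
  have hhg : h * g = 1 := mul_eq_one_comm.1 hgh
  induction x using FreeAlgebra.induction with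
  | grade0 r => simp [Algebra.algebraMap_eq_smul_one, hgh]
  | grade1 i => simp
  | mul a b ha hb =>
    rw [map_mul, map_mul, ha, hb]
    calc g * evalTuple A a * h * (g * evalTuple A b * h)
        = g * evalTuple A a * (h * g) * evalTuple A b * h := by simp only [mul_assoc]
      _ = _ := by rw [hhg]; simp only [mul_assoc, one_mul]
  | add a b ha hb => rw [map_add, map_add, ha, hb, mul_add, add_mul]

theorem exists_conj_of_mem_conjOrbit {A B : Fin m → Matrix (Fin n) (Fin n) K}
    (hB : B ∈ conjOrbit A) : ∃ g h : Matrix (Fin n) (Fin n) K, g * h = 1 ∧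
      ∀ x : FreeAlgebra K (Fin m), evalTuple B x = g * evalTuple A x * h := by
  obtain ⟨u, rfl⟩ := hB
  exact ⟨u.1, u.2, u.3, evalTuple_conj A u.3⟩

/-- A relation among the matrices is a system of polynomial equations in their entries, read off
from the generic tuple, and it is conjugation invariant. -/
theorem evalTuple_eq_zero_of_mem_closure {A D : Fin m → Matrix (Fin n) (Fin n) K}
    (hD : D ∈ zariskiClosure (conjOrbit A)) {x : FreeAlgebra K (Fin m)}
    (hx : evalTuple A x = 0) : evalTuple D x = 0 := by
  ext a b
  have key : ∀ B : Fin m → Matrix (Fin n) (Fin n) K, MvPolynomial.aeval (coords B)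
      (evalTuple (genericTuple K m n) x a b) = evalTuple B x a b := fun B => by
    rw [← evalTuple_genericTuple_map B x, Matrix.map_apply]
  have h := mem_zariskiClosure_iff.1 hD (evalTuple (genericTuple K m n) x a b) fun B hB => by
    obtain ⟨g, h, -, hB⟩ := exists_conj_of_mem_conjOrbit hB
    rw [key, hB, hx]
    simp
  rw [← key, h, Matrix.zero_apply]

/-- `det (1 + t M)` over an arbitrary commutative ring and index type. -/
def detOneAdd {S ι : Type*} [CommRing S] [Fintype ι] [DecidableEq ι] (M : Matrix ι ι S) : S[X] :=
  (1 + (Polynomial.X : S[X]) • M.map Polynomial.C).det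

theorem detOneAdd_eq_detOneAddT (M : Matrix (Fin n) (Fin n) K) :
    detOneAdd M = detOneAddT M := rfl

theorem detOneAdd_conj {S ι κ : Type*} [CommRing S] [Fintype ι] [DecidableEq ι] [Fintype κ]
    [DecidableEq κ] (M : Matrix ι ι S) {g : Matrix κ ι S} {h : Matrix ι κ S} (hgh : g * h = 1)
    (hhg : h * g = 1) : detOneAdd (g * M * h) = detOneAdd M := by
  have h1 : g.map Polynomial.C * h.map Polynomial.C = 1 := by
    rw [← Matrix.map_mul, hgh]; simp
  have h2 : h.map Polynomial.C * g.map Polynomial.C = 1 := by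
    rw [← Matrix.map_mul, hhg]; simp
  unfold detOneAdd
  rw [← Matrix.det_conj_of_mul_eq_one (N := 1 + (Polynomial.X : S[X]) • M.map Polynomial.C) h1 h2]
  rw [Matrix.map_mul, Matrix.map_mul, Matrix.mul_add, Matrix.add_mul, Matrix.mul_one, h1,
    Matrix.mul_smul, Matrix.smul_mul]

theorem detOneAdd_map {S T ι : Type*} [CommRing S] [CommRing T] [Fintype ι] [DecidableEq ι]
    (φ : S →+* T) (M : Matrix ι ι S) : (detOneAdd M).map φ = detOneAdd (M.map φ) := by
  unfold detOneAdd
  rw [← Polynomial.coe_mapRingHom, RingHom.map_det]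
  congr 1
  ext a b : 1
  simp [Matrix.one_apply, apply_ite]

theorem detOneAddT_evalTuple_of_mem_closure {A D : Fin m → Matrix (Fin n) (Fin n) K}
    (hD : D ∈ zariskiClosure (conjOrbit A)) (x : FreeAlgebra K (Fin m)) :
    detOneAddT (evalTuple D x) = detOneAddT (evalTuple A x) := by
  have key : ∀ (B : Fin m → Matrix (Fin n) (Fin n) K) (k : ℕ), MvPolynomial.aeval (coords B)
      ((detOneAdd (evalTuple (genericTuple K m n) x)).coeff k) =
        (detOneAddT (evalTuple B x)).coeff k := fun B k => by
    rw [← detOneAdd_eq_detOneAddT, ← evalTuple_genericTuple_map B x]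
    have h := detOneAdd_map (MvPolynomial.aeval (coords B)).toRingHom
      (evalTuple (genericTuple K m n) x)
    exact (Polynomial.coeff_map _ _).symm.trans (congrArg (fun f : K[X] => f.coeff k) h)
  ext k
  rw [← key, ← key]
  refine aeval_eq_of_mem_closure hD _ fun B hB => ?_
  obtain ⟨g, h, hgh, hB⟩ := exists_conj_of_mem_conjOrbit hB
  rw [key, key, hB, ← detOneAdd_eq_detOneAddT, detOneAdd_conj _ hgh (mul_eq_one_comm.1 hgh),
    detOneAdd_eq_detOneAddT]

/-- If a curve, polynomial in `t`, lies in the closure of `S` for all `t ≠ 0`, so does its point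
at `t = 0`. -/
theorem mem_zariskiClosure_of_curve [Infinite K] {S : Set (Fin m → Matrix (Fin n) (Fin n) K)}
    (D E : Fin m → Matrix (Fin n) (Fin n) K)
    (h : ∀ t : K, t ≠ 0 → (fun i => D i + t • E i) ∈ zariskiClosure S) :
    D ∈ zariskiClosure S := by
  rw [mem_zariskiClosure_iff]
  intro f hf
  -- `P` is `f` restricted to the curve; it has infinitely many roots, so it also vanishes at `0`.
  set P : K[X] := MvPolynomial.aeval
    (fun q => Polynomial.C (coords D q) + Polynomial.X * Polynomial.C (coords E q)) f with hP
  have key : ∀ t : K, P.eval t = MvPolynomial.aeval (coords fun i => D i + t • E i) f := by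
    intro t
    rw [hP, ← Polynomial.coe_aeval_eq_eval, ← AlgHom.comp_apply, MvPolynomial.comp_aeval]
    congr 2
    funext q
    simp only [coords, map_add, map_mul, Polynomial.aeval_C, Polynomial.aeval_X]
    rfl
  have hP0 : P = 0 := by
    refine Polynomial.eq_zero_of_infinite_isRoot P ?_
    refine (Set.Finite.infinite_compl (Set.finite_singleton (0 : K))).mono fun t ht => ?_
    rw [Set.mem_ofPred_eq, Polynomial.IsRoot, key]
    exact mem_zariskiClosure_iff.1 (h t ht) f hf
  simpa [hP0] using (key 0).symm

/-- Degeneration of a tuple along an idempotent whose range is an invariant subspace. -/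
theorem degeneration_mem_zariskiClosure [Infinite K] {A D : Fin m → Matrix (Fin n) (Fin n) K}
    (hD : D ∈ zariskiClosure (conjOrbit A)) {p : Matrix (Fin n) (Fin n) K} (hp : p * p = p)
    (hpD : ∀ i, p * D i * p = D i * p) :
    (fun i => p * D i * p + (1 - p) * D i * (1 - p)) ∈ zariskiClosure (conjOrbit A) := by
  -- Conjugation by `t p + (1 - p)` scales the off-diagonal block `p D (1 - p)` by `t`; the opposite
  -- block `(1 - p) D p` is zero by invariance.
  refine mem_zariskiClosure_of_curve _ (fun i => p * D i * (1 - p)) fun t ht => ?_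
  have hgh : (t • p + (1 - p)) * (t⁻¹ • p + (1 - p)) = 1 := by
    simp only [add_mul, mul_add, mul_sub, sub_mul, Matrix.smul_mul, Matrix.mul_smul, hp, smul_smul,
      mul_one, one_mul, inv_mul_cancel₀ ht, one_smul, sub_self]
    abel
  convert conj_mem_zariskiClosure hD hgh using 2 with i
  simp only [add_mul, mul_add, mul_sub, sub_mul, Matrix.smul_mul, Matrix.mul_smul, smul_smul,
      mul_one, one_mul, inv_mul_cancel₀ ht, smul_sub, one_smul, hpD]
  abel

/-- Taking diagonal blocks is multiplicative on block triangular matrices. Triangularity is proved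
simultaneously because the product step needs it. -/
theorem evalTuple_degeneration {D : Fin m → Matrix (Fin n) (Fin n) K}
    {p : Matrix (Fin n) (Fin n) K} (hp : p * p = p) (hpD : ∀ i, p * D i * p = D i * p)
    (x : FreeAlgebra K (Fin m)) :
    p * evalTuple D x * p = evalTuple D x * p ∧
      evalTuple (fun i => p * D i * p + (1 - p) * D i * (1 - p)) x =
        p * evalTuple D x * p + (1 - p) * evalTuple D x * (1 - p) := by
  induction x using FreeAlgebra.induction with
  | grade0 r =>
    rw [AlgHom.commutes, AlgHom.commutes, Algebra.algebraMap_eq_smul_one]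
    simp only [Matrix.mul_smul, mul_one, Matrix.smul_mul, hp, one_mul, true_and, mul_sub, sub_mul]
    abel
  | grade1 i => simpa using hpD i
  | mul a b ha hb =>
    obtain ⟨ha, ha'⟩ := ha
    obtain ⟨hb, hb'⟩ := hb
    rw [map_mul, map_mul, ha', hb']
    generalize evalTuple D a = X at *
    generalize evalTuple D b = Y at *
    have h1 : X * Y * p = X * p * Y * p := by rw [mul_assoc, ← hb]; simp only [mul_assoc]
    have h2 : p * (X * Y) * p = X * Y * p := by
      rw [← mul_assoc, mul_assoc p, mul_assoc p, h1, ← mul_assoc, ← mul_assoc, ← mul_assoc, ha]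
    refine ⟨h2, ?_⟩
    have hpp : ∀ Z, p * (p * Z) = p * Z := fun Z => by rw [← mul_assoc, hp]
    have hX : ∀ Z, X * (p * Z) = p * (X * (p * Z)) := fun Z => by
      rw [← mul_assoc, ← ha]; simp only [mul_assoc, hpp]
    have hYp : p * (Y * p) = Y * p := by rw [← mul_assoc, hb]
    have hXYp : p * (X * (Y * p)) = X * (Y * p) := by simpa only [mul_assoc] using h2
    have hpXpY : ∀ Z, p * (X * (p * Z)) = X * (p * Z) := fun Z => (hX Z).symm
    simp only [mul_add, add_mul, mul_sub, sub_mul, mul_one, one_mul, mul_assoc, hpp, hYp, hXYp,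
      hpXpY]
    abel
  | add a b ha hb =>
    rw [map_add, map_add, ha.2, hb.2]
    refine ⟨by rw [mul_add, add_mul, add_mul, ha.1, hb.1], ?_⟩
    simp only [mul_add, add_mul]
    abel

end Closure

/-! ### Degeneration to a semisimple algebra -/

section Semisimple

/-- The last nonzero power of the Jacobson radical works: non-semisimplicity makes the nilpotency
index some `k + 2`, and `2 (k + 1) ≥ k + 2`. -/
theorem exists_squareZero_ideal {R : Type*} [Ring R] [IsArtinianRing R]
    (h : ¬ IsSemisimpleRing R) : ∃ I : Ideal R, I ≠ ⊥ ∧ ∀ x ∈ I, ∀ y ∈ I, x * y = 0 := by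
  classical
  rw [IsArtinianRing.isSemisimpleRing_iff_jacobson] at h
  have hnil : ∃ k, Ring.jacobson R ^ k = ⊥ := IsSemiprimaryRing.isNilpotent
  obtain ⟨k, hk⟩ : ∃ k, Nat.find hnil = k + 2 := by
    have h0 : Nat.find hnil ≠ 0 := fun h0 => by
      have := Nat.find_spec hnil
      rw [h0, Submodule.pow_zero, Ideal.one_eq_top] at this
      exact h (le_bot_iff.1 (this ▸ le_top))
    have h1 : Nat.find hnil ≠ 1 := fun h1 => by
      have := Nat.find_spec hnil
      rw [h1, Submodule.pow_one] at this
      exact h this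
    exact ⟨Nat.find hnil - 2, by omega⟩
  have hspec := Nat.find_spec hnil
  refine ⟨Ring.jacobson R ^ (k + 1), Nat.find_min hnil (by omega), fun x hx y hy => ?_⟩
  have := Ideal.mul_mem_mul hx hy
  rw [← Ideal.IsTwoSided.pow_add] at this
  have hle : Ring.jacobson R ^ (k + 1 + (k + 1)) ≤ Ring.jacobson R ^ (Nat.find hnil) :=
    Ideal.pow_le_pow_right (by omega)
  rw [hspec] at hle
  exact hle this

/-- The map `g` factors through the range of `f`; the induced surjection onto the range of `g` is
injective by dimension count. -/
theorem ker_le_ker_of_finrank_le {K V M N : Type*} [Field K] [AddCommGroup V] [Module K V]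
    [AddCommGroup M] [Module K M] [AddCommGroup N] [Module K N] [FiniteDimensional K M]
    (f : V →ₗ[K] M) (g : V →ₗ[K] N) (h : LinearMap.ker f ≤ LinearMap.ker g)
    (hfin : Module.finrank K (LinearMap.range f) ≤ Module.finrank K (LinearMap.range g)) :
    LinearMap.ker g ≤ LinearMap.ker f := by
  let u : LinearMap.range f →ₗ[K] N :=
    ((LinearMap.ker f).liftQ g h).comp f.quotKerEquivRange.symm.toLinearMap
  have hu : ∀ x, u ⟨f x, x, rfl⟩ = g x := by
    intro x
    have : f.quotKerEquivRange.symm ⟨f x, x, rfl⟩ = (LinearMap.ker f).mkQ x := by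
      rw [LinearEquiv.symm_apply_eq]; rfl
    simp [u, this]
  have hrange : LinearMap.range u = LinearMap.range g := by
    ext y
    constructor
    · rintro ⟨⟨_, x, rfl⟩, rfl⟩
      exact ⟨x, (hu x).symm⟩
    · rintro ⟨x, rfl⟩
      exact ⟨_, hu x⟩
  have hrk := u.finrank_range_add_finrank_ker
  rw [hrange] at hrk
  have hker : LinearMap.ker u = ⊥ := by
    rw [← Submodule.finrank_eq_zero (R := K)]
    omega
  intro x hx
  have : (⟨f x, x, rfl⟩ : LinearMap.range f) ∈ LinearMap.ker u := by
    rw [LinearMap.mem_ker, hu, hx]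
  rw [hker, Submodule.mem_bot] at this
  exact congrArg Subtype.val this

/-- A matrix projecting onto a given subspace. -/
theorem exists_idempotent_range {K : Type*} [Field K] {n : ℕ} (W : Submodule K (Fin n → K)) :
    ∃ p : Matrix (Fin n) (Fin n) K, (∀ v, p.mulVec v ∈ W) ∧ ∀ w ∈ W, p.mulVec w = w := by
  obtain ⟨q, hq⟩ := W.subtype.exists_leftInverse_of_injective W.ker_subtype
  refine ⟨LinearMap.toMatrix' (W.subtype ∘ₗ q), fun v => ?_, fun w hw => ?_⟩
  · rw [LinearMap.toMatrix'_mulVec]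
    exact (q v).2
  · rw [LinearMap.toMatrix'_mulVec]
    exact congrArg Subtype.val (LinearMap.congr_fun hq ⟨w, hw⟩)

variable {K : Type*} [Field K] {m n : ℕ}

/-- A set of matrices that multiplies to zero with itself and is absorbed on the left by a tuple
is annihilated by a degeneration of this tuple. -/
theorem exists_degeneration [Infinite K] {A D : Fin m → Matrix (Fin n) (Fin n) K}
    (hD : D ∈ zariskiClosure (conjOrbit A)) (I : Set (FreeAlgebra K (Fin m)))
    (hI : ∀ x ∈ I, ∀ y ∈ I, evalTuple D (x * y) = 0)
    (hDI : ∀ i, ∀ x ∈ I, FreeAlgebra.ι K i * x ∈ I) :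
    ∃ E ∈ zariskiClosure (conjOrbit A),
      (∀ x : FreeAlgebra K (Fin m), evalTuple D x = 0 → evalTuple E x = 0) ∧
      ∀ x ∈ I, evalTuple E x = 0 := by
  -- `W = I · Kⁿ` is invariant because `I` absorbs the tuple on the left. Each `x ∈ I` maps into `W`
  -- and kills `W`, so both of its diagonal blocks are zero.
  let W : Submodule K (Fin n → K) :=
    Submodule.span K {v | ∃ x ∈ I, ∃ u, v = (evalTuple D x).mulVec u}
  obtain ⟨p, hpW, hWp⟩ := exists_idempotent_range W
  have hp : p * p = p := by
    refine Matrix.ext_of_mulVec_single fun i => ?_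
    rw [← Matrix.mulVec_mulVec, hWp _ (hpW _)]
  have hWD : ∀ i, ∀ w ∈ W, (D i).mulVec w ∈ W := by
    intro i w hw
    induction hw using Submodule.span_induction with
    | mem w hw =>
      obtain ⟨x, hx, u, rfl⟩ := hw
      refine Submodule.subset_span ⟨_, hDI i x hx, u, ?_⟩
      rw [map_mul, Matrix.mulVec_mulVec]
      simp
    | zero => simp
    | add a b _ _ ha hb => rw [Matrix.mulVec_add]; exact W.add_mem ha hb
    | smul c a _ ha => rw [Matrix.mulVec_smul]; exact W.smul_mem c ha
  have hpD : ∀ i, p * D i * p = D i * p := by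
    intro i
    refine Matrix.ext_of_mulVec_single fun j => ?_
    rw [mul_assoc, ← Matrix.mulVec_mulVec, ← Matrix.mulVec_mulVec, hWp _ (hWD i _ (hpW _))]
  refine ⟨_, degeneration_mem_zariskiClosure hD hp hpD, fun x hx => ?_, fun x hx => ?_⟩
  · rw [(evalTuple_degeneration hp hpD x).2, hx]
    simp
  · rw [(evalTuple_degeneration hp hpD x).2]
    have hWx : ∀ w ∈ W, (evalTuple D x).mulVec w = 0 := by
      intro w hw
      induction hw using Submodule.span_induction with
      | mem w hw =>
        obtain ⟨y, hy, u, rfl⟩ := hw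
        rw [Matrix.mulVec_mulVec, ← map_mul, hI x hx y hy, Matrix.zero_mulVec]
      | zero => simp
      | add a b _ _ ha hb => rw [Matrix.mulVec_add, ha, hb, add_zero]
      | smul c a _ ha => rw [Matrix.mulVec_smul, ha, smul_zero]
    have hxp : evalTuple D x * p = 0 := by
      refine Matrix.ext_of_mulVec_single fun j => ?_
      rw [← Matrix.mulVec_mulVec, hWx _ (hpW _), Matrix.zero_mulVec]
    have hpx : p * evalTuple D x = evalTuple D x := by
      refine Matrix.ext_of_mulVec_single fun j => ?_
      rw [← Matrix.mulVec_mulVec, hWp _ (Submodule.subset_span ⟨x, hx, _, rfl⟩)]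
    rw [mul_assoc, hxp, sub_mul, one_mul, hpx, sub_self, mul_zero, zero_mul, add_zero]

/-- The pair of values of a noncommutative polynomial at two tuples of matrices. -/
abbrev evalPair (A B : Fin m → Matrix (Fin n) (Fin n) K) : FreeAlgebra K (Fin m) →ₐ[K]
    Matrix (Fin n) (Fin n) K × Matrix (Fin n) (Fin n) K :=
  (evalTuple A).prod (evalTuple B)

/-- Two tuples can be degenerated so that they generate a semisimple algebra. -/
theorem exists_semisimple_degeneration [Infinite K] (A B : Fin m → Matrix (Fin n) (Fin n) K) :
    ∃ D ∈ zariskiClosure (conjOrbit A), ∃ E ∈ zariskiClosure (conjOrbit B),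
      IsSemisimpleRing (evalPair D E).range := by
  classical
  have hself : ∀ A : Fin m → Matrix (Fin n) (Fin n) K, A ∈ zariskiClosure (conjOrbit A) :=
    fun A => subset_zariskiClosure _ ⟨1, by simp⟩
  let rk : (Fin m → Matrix (Fin n) (Fin n) K) × (Fin m → Matrix (Fin n) (Fin n) K) → ℕ :=
    fun q => Module.finrank K (LinearMap.range (evalPair q.1 q.2).toLinearMap)
  have hne : ∃ k, ∃ D ∈ zariskiClosure (conjOrbit A), ∃ E ∈ zariskiClosure (conjOrbit B),
      rk (D, E) = k := ⟨_, A, hself A, B, hself B, rfl⟩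
  obtain ⟨D, hD, E, hE, hk⟩ := Nat.find_spec hne
  refine ⟨D, hD, E, hE, ?_⟩
  by_contra hss
  have : IsArtinianRing (evalPair D E).range := IsArtinianRing.of_finite K _
  obtain ⟨I, hI0, hI⟩ := exists_squareZero_ideal hss
  -- Pulled back to the free algebra, `I` can be killed in `D` and in `E` separately.
  let I' : Set (FreeAlgebra K (Fin m)) := {x | (evalPair D E).rangeRestrict x ∈ I}
  have hII : ∀ x ∈ I', ∀ y ∈ I', evalPair D E (x * y) = 0 := fun x hx y hy => by
    have := congrArg Subtype.val (hI _ hx _ hy)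
    rw [map_mul]
    exact this
  have hlI : ∀ i, ∀ x ∈ I', FreeAlgebra.ι K i * x ∈ I' := fun i x hx => by
    change (evalPair D E).rangeRestrict _ ∈ I
    rw [map_mul]
    exact I.mul_mem_left _ hx
  obtain ⟨D', hD', hDD, hID⟩ := exists_degeneration hD I'
    (fun x hx y hy => congrArg Prod.fst (hII x hx y hy)) hlI
  obtain ⟨E', hE', hEE, hIE⟩ := exists_degeneration hE I'
    (fun x hx y hy => congrArg Prod.snd (hII x hx y hy)) hlI
  -- By minimality the degenerate pair satisfies no new relations, yet it kills `I`.
  have hker := ker_le_ker_of_finrank_le (evalPair D E).toLinearMap (evalPair D' E').toLinearMap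
    (fun x hx => Prod.ext (hDD x (congrArg Prod.fst hx)) (hEE x (congrArg Prod.snd hx)))
    (hk.trans_le (Nat.find_min' hne ⟨D', hD', E', hE', rfl⟩))
  refine hI0 ((Submodule.eq_bot_iff _).2 ?_)
  rintro ⟨_, x, rfl⟩ hx
  exact Subtype.ext (hker (Prod.ext (hID x hx) (hIE x hx) : evalPair D' E' x = 0))

end Semisimple

/-! ### Representations of products of matrix algebras -/

section Representations

theorem det_blockDiagonal_dependent {S o : Type*} [CommRing S] [Fintype o] [DecidableEq o]
    {m : o → Type*} [∀ i, Fintype (m i)] [∀ i, DecidableEq (m i)] (M : ∀ i, Matrix (m i) (m i) S) :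
    (Matrix.blockDiagonal' M).det = ∏ i, (M i).det := by
  -- An arbitrary linear order on the blocks makes the matrix block triangular.
  let b : (Σ i, m i) → Fin (Fintype.card o) := fun x => Fintype.equivFin o x.1
  have hb : (Matrix.blockDiagonal' M).BlockTriangular b := by
    rintro ⟨i, a⟩ ⟨j, c⟩ hij
    refine Matrix.blockDiagonal'_apply_ne _ _ _ fun h => ?_
    subst h
    exact lt_irrefl _ hij
  rw [hb.det_fintype, ← (Fintype.equivFin o).prod_comp]
  refine Finset.prod_congr rfl fun i _ => ?_
  let e : m i ≃ {x // b x = Fintype.equivFin o i} :=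
    { toFun := fun a => ⟨⟨i, a⟩, rfl⟩
      invFun := fun x => ((Fintype.equivFin o).injective x.2) ▸ x.1.2
      left_inv := fun a => rfl
      right_inv := by
        rintro ⟨⟨j, a⟩, hj⟩
        obtain rfl := (Fintype.equivFin o).injective hj
        rfl }
  rw [← Matrix.det_submatrix_equiv_self e]
  congr 1
  ext a c
  simp [Matrix.toSquareBlock_def, e]

theorem detOneAdd_blockDiagonal {S o : Type*} [CommRing S] [Fintype o] [DecidableEq o]
    {m : o → Type*} [∀ i, Fintype (m i)] [∀ i, DecidableEq (m i)] (M : ∀ i, Matrix (m i) (m i) S) :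
    detOneAdd (Matrix.blockDiagonal' M) = ∏ i, detOneAdd (M i) := by
  unfold detOneAdd
  rw [← det_blockDiagonal_dependent, Matrix.blockDiagonal'_map _ _ (map_zero _),
    ← Matrix.blockDiagonal'_smul, ← Matrix.blockDiagonal'_one, ← Matrix.blockDiagonal'_add]
  rfl

variable {K : Type*} [Field K] {n k : ℕ} {d : Fin k → ℕ}

/-- The elementary matrix `E_{ab}` in the `i`-th factor of a product of matrix algebras. -/
def piSingle (K : Type*) [Field K] {k : ℕ} {d : Fin k → ℕ} (i : Fin k) (a b : Fin (d i)) :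
    ∀ i, Matrix (Fin (d i)) (Fin (d i)) K :=
  Pi.single i (Matrix.single a b 1)

theorem piSingle_mul_same (i : Fin k) (a b c e : Fin (d i)) :
    piSingle K i a b * piSingle K i c e = if b = c then piSingle K i a e else 0 := by
  unfold piSingle
  rw [← Pi.single_mul]
  split_ifs with h
  · subst h; simp
  · simp [Matrix.single_mul_single_of_ne, h]

theorem piSingle_mul_of_ne {i j : Fin k} (hij : i ≠ j) (a b : Fin (d i)) (c e : Fin (d j)) :
    piSingle K i a b * piSingle K j c e = 0 := by
  funext l
  unfold piSingle
  rw [Pi.mul_apply]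
  by_cases h : l = i
  · subst h; simp [hij]
  · simp [h]

theorem piSingle_mul (i : Fin k) (a b : Fin (d i)) (z : ∀ i, Matrix (Fin (d i)) (Fin (d i)) K) :
    piSingle K i a b * z = ∑ c, z i b c • piSingle K i a c := by
  funext l
  unfold piSingle
  rw [Pi.mul_apply, Finset.sum_apply]
  by_cases h : l = i
  · subst h
    ext r s
    simp only [Pi.single_eq_same, Pi.smul_apply, Matrix.sum_apply, Matrix.smul_apply]
    by_cases hr : r = a
    · subst hr; simp [Matrix.single_apply]
    · simp [hr, Ne.symm hr]
  · simp [h]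

theorem sum_piSingle : ∑ i, ∑ a, piSingle K (d := d) i a a = 1 := by
  funext l
  simp only [piSingle, Finset.sum_apply]
  rw [Finset.sum_eq_single l]
  · ext r s
    simp [Matrix.sum_apply, Matrix.single_apply, Matrix.one_apply, ite_and]
  · intro i _ hi
    simp [Pi.single_eq_of_ne hi.symm]
  · simp

/-- Every representation of a product of matrix algebras is a direct sum of copies of the
standard representations of the factors. -/
theorem exists_conj_blockDiagonal [∀ i, NeZero (d i)]
    (ρ : (∀ i, Matrix (Fin (d i)) (Fin (d i)) K) →ₐ[K] Matrix (Fin n) (Fin n) K) :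
    ∃ (N : Fin k → ℕ) (g : Matrix (Σ x : (Σ i, Fin (N i)), Fin (d x.1)) (Fin n) K)
      (h : Matrix (Fin n) (Σ x : (Σ i, Fin (N i)), Fin (d x.1)) K), g * h = 1 ∧ h * g = 1 ∧
      ∀ z, g * ρ z * h = Matrix.blockDiagonal' fun x : (Σ i, Fin (N i)) => z x.1 := by
  -- `V i`, the image of the idempotent `E_00` of factor `i`, is the multiplicity space. `G` records
  -- the coordinates of `E_0a v` in `V i`, and `H` moves basis vectors back by `E_a0`.
  let V : Fin k → Submodule K (Fin n → K) :=
    fun i => LinearMap.range (ρ (piSingle K i 0 0)).mulVecLin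
  let b : ∀ i, Module.Basis (Fin (Module.finrank K (V i))) K (V i) :=
    fun i => Module.finBasis K (V i)
  have hV : ∀ i a v, (ρ (piSingle K i 0 a)).mulVec v ∈ V i := fun i a v => by
    refine ⟨(ρ (piSingle K i 0 a)).mulVec v, ?_⟩
    rw [Matrix.mulVecLin_apply, Matrix.mulVec_mulVec, ← map_mul, piSingle_mul_same, if_pos rfl]
  have hVid : ∀ i, ∀ v ∈ V i, (ρ (piSingle K i 0 0)).mulVec v = v := by
    rintro i _ ⟨v, rfl⟩
    rw [Matrix.mulVecLin_apply, Matrix.mulVec_mulVec, ← map_mul, piSingle_mul_same, if_pos rfl]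
  let P : ∀ i, Fin (d i) → (Fin n → K) →ₗ[K] V i :=
    fun i a => (ρ (piSingle K i 0 a)).mulVecLin.codRestrict (V i) (hV i a)
  let G : (Fin n → K) →ₗ[K]
      ((Σ x : (Σ i, Fin (Module.finrank K (V i))), Fin (d x.1)) → K) :=
    LinearMap.pi fun x => (b x.1.1).coord x.1.2 ∘ₗ P x.1.1 x.2
  let H : ((Σ x : (Σ i, Fin (Module.finrank K (V i))), Fin (d x.1)) → K) →ₗ[K] (Fin n → K) :=
    Fintype.linearCombination K
      fun x => (ρ (piSingle K x.1.1 x.2 0)).mulVec (b x.1.1 x.1.2 : Fin n → K)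
  have hGH : G ∘ₗ H = LinearMap.id := by
    refine LinearMap.pi_ext' fun x => LinearMap.ext_ring ?_
    obtain ⟨⟨i, j⟩, a⟩ := x
    funext y
    obtain ⟨⟨i', j'⟩, a'⟩ := y
    have hP : P i' a' ((ρ (piSingle K i a 0)).mulVec (b i j : Fin n → K)) =
        if h : i = i' then if h ▸ a = a' then h ▸ b i j else 0 else 0 := by
      refine Subtype.ext ?_
      change (ρ (piSingle K i' 0 a')).mulVec _ = _
      rw [Matrix.mulVec_mulVec, ← map_mul]
      by_cases h : i = i'
      · subst h
        rw [piSingle_mul_same]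
        by_cases ha : a = a'
        · subst ha
          simp [hVid i _ (b i j).2]
        · simp [ha, Ne.symm ha]
      · rw [piSingle_mul_of_ne (Ne.symm h)]
        simp [h]
    have hH : H (Pi.single ⟨⟨i, j⟩, a⟩ 1) = (ρ (piSingle K i a 0)).mulVec (b i j : Fin n → K) := by
      simp [H, Fintype.linearCombination_apply_single]
    change (b i').repr (P i' a' (H (Pi.single ⟨⟨i, j⟩, a⟩ 1))) j' = _
    rw [hH, hP]
    by_cases h : i = i'
    · subst h
      by_cases ha : a = a'
      · subst ha
        simp [Finsupp.single_apply, Pi.single_apply, eq_comm]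
      · simp [ha, Ne.symm ha]
    · simp [h, Ne.symm h]
  -- Since `E_a0 E_0a = E_aa`, this reduces to the `E_aa` summing to `1`.
  have hHG : H ∘ₗ G = LinearMap.id := by
    refine LinearMap.ext fun v => ?_
    have h1 : ∀ i a, ∑ j, (b i).repr (P i a v) j •
        (ρ (piSingle K i a 0)).mulVec (b i j : Fin n → K) = (ρ (piSingle K i a a)).mulVec v := by
      intro i a
      simp_rw [← Matrix.mulVec_smul]
      rw [← Matrix.mulVec_sum]
      have h2 := congrArg Subtype.val ((b i).sum_repr (P i a v))
      simp only [AddSubmonoidClass.coe_finsetSum, SetLike.val_smul] at h2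
      rw [h2]
      rw [show ((P i a v : V i) : Fin n → K) = (ρ (piSingle K i 0 a)).mulVec v from rfl,
        Matrix.mulVec_mulVec, ← map_mul, piSingle_mul_same, if_pos rfl]
    calc H (G v) = ∑ x : (Σ x : (Σ i, Fin (Module.finrank K (V i))), Fin (d x.1)),
          (b x.1.1).repr (P x.1.1 x.2 v) x.1.2 •
            (ρ (piSingle K x.1.1 x.2 0)).mulVec (b x.1.1 x.1.2 : Fin n → K) := rfl
      _ = ∑ i, ∑ a, (ρ (piSingle K i a a)).mulVec v := by
        rw [Fintype.sum_sigma, Fintype.sum_sigma]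
        refine Finset.sum_congr rfl fun i _ => ?_
        exact (Finset.sum_comm (s := Finset.univ) (t := Finset.univ)
          (f := fun j a => (b i).repr (P i a v) j • (ρ (piSingle K i a 0)).mulVec (b i j : Fin n → K))).trans
          (Finset.sum_congr rfl fun a _ => h1 i a)
      _ = v := by
        simp_rw [← Matrix.sum_mulVec, ← map_sum]
        rw [sum_piSingle, map_one, Matrix.one_mulVec]
  have hGz : ∀ z v x, G ((ρ z).mulVec v) x = ∑ c, z x.1.1 x.2 c * G v ⟨x.1, c⟩ := by
    intro z v x
    have hP : P x.1.1 x.2 ((ρ z).mulVec v) = ∑ c, z x.1.1 x.2 c • P x.1.1 c v := by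
      refine Subtype.ext ?_
      change (ρ (piSingle K x.1.1 0 x.2)).mulVec _ = _
      rw [Matrix.mulVec_mulVec, ← map_mul, piSingle_mul, map_sum, Matrix.sum_mulVec]
      simp only [map_smul, Matrix.smul_mulVec, AddSubmonoidClass.coe_finsetSum, SetLike.val_smul]
      rfl
    change (b x.1.1).coord x.1.2 (P x.1.1 x.2 ((ρ z).mulVec v)) = _
    rw [hP, map_sum]
    simp only [map_smul]
    rfl
  refine ⟨fun i => Module.finrank K (V i), LinearMap.toMatrix' G, LinearMap.toMatrix' H, ?_, ?_,
    fun z => ?_⟩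
  · rw [← LinearMap.toMatrix'_comp, hGH, LinearMap.toMatrix'_id]
  · rw [← LinearMap.toMatrix'_comp, hHG, LinearMap.toMatrix'_id]
  · have h1 : LinearMap.toMatrix' G * ρ z * LinearMap.toMatrix' H =
        LinearMap.toMatrix' (G ∘ₗ (ρ z).toLin' ∘ₗ H) := by
      rw [LinearMap.toMatrix'_comp, LinearMap.toMatrix'_comp, LinearMap.toMatrix'_toLin',
        Matrix.mul_assoc]
    rw [h1]
    ext x y
    rw [LinearMap.toMatrix'_apply, LinearMap.comp_apply, LinearMap.comp_apply, Matrix.toLin'_apply,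
      hGz]
    have h2 : ∀ c, G (H (Pi.single y 1)) ⟨x.1, c⟩ = (Pi.single y 1 : _ → K) ⟨x.1, c⟩ :=
      fun c => congrFun (LinearMap.congr_fun hGH (Pi.single y 1)) _
    simp only [h2]
    obtain ⟨x, a⟩ := x
    obtain ⟨y, c⟩ := y
    by_cases hxy : x = y
    · subst hxy
      simp [Pi.single_apply]
    · simp [Matrix.blockDiagonal'_apply_ne _ _ _ hxy, hxy]

end Representations

/-! ### Recovering multiplicities in any characteristic -/

section Exponents

variable {K : Type*} [Field K] {ι : Type*} [Fintype ι]

theorem coeff_prod_pow (q : ι → K[X]) (hq : ∀ i, (q i).coeff 0 = 1) (e : ι → ℕ) :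
    (∏ i, q i ^ e i).coeff 0 = 1 ∧ (∏ i, q i ^ e i).coeff 1 = ∑ i, (e i : K) * (q i).coeff 1 := by
  classical
  have hpow : ∀ i (l : ℕ), (q i ^ l).coeff 0 = 1 ∧ (q i ^ l).coeff 1 = l * (q i).coeff 1 := by
    intro i l
    induction l with
    | zero => simp [Polynomial.coeff_one]
    | succ l ih =>
      rw [pow_succ, Polynomial.mul_coeff_zero, Polynomial.mul_coeff_one, ih.1, ih.2, hq]
      refine ⟨by ring, by push_cast; ring⟩
  suffices ∀ s : Finset ι, (∏ i ∈ s, q i ^ e i).coeff 0 = 1 ∧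
      (∏ i ∈ s, q i ^ e i).coeff 1 = ∑ i ∈ s, (e i : K) * (q i).coeff 1 from this _
  intro s
  induction s using Finset.induction_on with
  | empty => simp [Polynomial.coeff_one]
  | insert i s hi ih =>
    rw [Finset.prod_insert hi, Finset.sum_insert hi, Polynomial.mul_coeff_zero,
      Polynomial.mul_coeff_one, ih.1, ih.2, (hpow i _).1, (hpow i _).2]
    exact ⟨by ring, by ring⟩

theorem prod_pow_eq_mul (q : ι → K[X]) [DecidableEq ι] (e : ι → ℕ) {i : ι} (hi : e i ≠ 0) :
    ∏ j, q j ^ e j = (∏ j, q j ^ (e j - if j = i then 1 else 0)) * q i := by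
  have : q i = ∏ j, if j = i then q j else 1 := by simp
  rw [this, ← Finset.prod_mul_distrib]
  refine Finset.prod_congr rfl fun j _ => ?_
  by_cases h : j = i
  · subst h
    rw [if_pos rfl, if_pos rfl, ← pow_succ, Nat.sub_add_cancel (Nat.one_le_iff_ne_zero.2 hi)]
  · simp [h]

/-- If products of powers of polynomials `1 + τᵢ(z) t + ⋯` agree for all `z` in a spanning set,
where the `τᵢ` are linear functionals with a dual family, then the exponents agree. -/
theorem exponents_eq_of_prod_pow_eq {T V : Type*} [AddCommGroup V] [Module K V] (z : T → V)
    (hz : Submodule.span K (Set.range z) = ⊤) (τ : ι → V →ₗ[K] K)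
    (hτ : ∀ i, ∃ v, τ i v = 1 ∧ ∀ j, j ≠ i → τ j v = 0) (q : T → ι → K[X])
    (hq0 : ∀ s i, (q s i).coeff 0 = 1) (hq1 : ∀ s i, (q s i).coeff 1 = τ i (z s)) (e f : ι → ℕ)
    (h : ∀ s, ∏ i, q s i ^ e i = ∏ i, q s i ^ f i) : e = f := by
  classical
  obtain ⟨N, hN⟩ : ∃ N, ∑ i, e i + ∑ i, f i = N := ⟨_, rfl⟩
  induction N using Nat.strong_induction_on generalizing e f with
  | _ N ih =>
    have hcast : ∀ i, (e i : K) = f i := by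
      -- The coefficient of `t` is linear in `z`, so agreement on the spanning set suffices.
      have hlin : ∑ i, (e i : K) • τ i = ∑ i, (f i : K) • τ i := by
        refine LinearMap.ext_on_range hz fun s => ?_
        have := congrArg (fun P : K[X] => P.coeff 1) (h s)
        simp only [(coeff_prod_pow _ (hq0 s) _).2, hq1] at this
        simpa [LinearMap.sum_apply] using this
      intro i
      obtain ⟨v, hv1, hv0⟩ := hτ i
      have hsum : ∀ a : ι → ℕ, (∑ j, (a j : K) • τ j) v = a i := fun a => by
        rw [LinearMap.sum_apply, Finset.sum_eq_single i]
        · simp [hv1]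
        · intro j _ hj; simp [hv0 j hj]
        · simp
      rw [← hsum e, hlin, hsum f]
    by_cases hcommon : ∃ i, e i ≠ 0 ∧ f i ≠ 0
    · obtain ⟨i, hei, hfi⟩ := hcommon
      -- Cancel one common factor `q s i`, nonzero because its constant term is `1`.
      let δ : ι → ℕ := fun j => if j = i then 1 else 0
      have hle : ∀ a : ι → ℕ, a i ≠ 0 → ∀ j, a j - δ j + δ j = a j := fun a ha j => by
        by_cases hj : j = i
        · subst hj; simp only [δ, if_pos]; omega
        · simp [δ, hj]
      have hsum : ∀ a : ι → ℕ, a i ≠ 0 → ∑ j, (a j - δ j) + 1 = ∑ j, a j := fun a ha => by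
        rw [← Finset.sum_congr rfl fun j _ => hle a ha j, Finset.sum_add_distrib]
        simp [δ]
      have := ih (∑ j, (e j - δ j) + ∑ j, (f j - δ j))
        (by have := hsum e hei; have := hsum f hfi; omega) (fun j => e j - δ j) (fun j => f j - δ j)
        (fun s => by
          have hs := h s
          rw [prod_pow_eq_mul _ e hei, prod_pow_eq_mul _ f hfi] at hs
          refine mul_right_cancel₀ (fun h0 => ?_) hs
          simpa [h0] using hq0 s i) rfl
      funext j
      have hj := congrFun this j
      have h1 := hle e hei j
      have h2 := hle f hfi j
      omega
    · push Not at hcommon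
      obtain ⟨p, hp⟩ := CharP.exists K
      rcases CharP.char_is_prime_or_zero K p with hprime | rfl
      -- At each index one exponent is `0` and both agree in `K`, so `p` divides both; then take
      -- `p`-th roots.
      · have hdvd : ∀ i, p ∣ e i ∧ p ∣ f i := fun i => by
          rw [← CharP.cast_eq_zero_iff K p, ← CharP.cast_eq_zero_iff K p, hcast i, and_self]
          by_cases hei : e i = 0
          · rw [← hcast i, hei, Nat.cast_zero]
          · rw [hcommon i hei, Nat.cast_zero]
        choose e' he' using fun i => (hdvd i).1
        choose f' hf' using fun i => (hdvd i).2
        have hse : ∑ i, e i = p * ∑ i, e' i := by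
          rw [Finset.mul_sum]; exact Finset.sum_congr rfl fun i _ => he' i
        have hsf : ∑ i, f i = p * ∑ i, f' i := by
          rw [Finset.mul_sum]; exact Finset.sum_congr rfl fun i _ => hf' i
        -- Dividing by `p` lowers the total only when it is positive.
        rcases Nat.eq_zero_or_pos N with hN0 | hN0
        · have h1 : ∑ i, e i = 0 := by omega
          have h2 : ∑ i, f i = 0 := by omega
          rw [Finset.sum_eq_zero_iff] at h1 h2
          funext i
          rw [h1 i (Finset.mem_univ _), h2 i (Finset.mem_univ _)]
        · have := Fact.mk hprime
          have hlt : ∑ i, e' i + ∑ i, f' i < N := by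
            rw [hse, hsf, ← mul_add] at hN
            have := hprime.two_le
            nlinarith
          have := ih _ hlt e' f' (fun s => by
            refine frobenius_inj K[X] p ?_
            simp only [frobenius_def, ← Finset.prod_pow, ← pow_mul]
            simp only [mul_comm _ p, ← he', ← hf', h s]) rfl
          funext i
          rw [he', hf', this]
      · have : CharZero K := CharP.charP_to_charZero K
        funext i
        exact_mod_cast hcast i

end Exponents

/-! ### Pivot words and the two implications -/

section Main

variable {K : Type*} [Field K] {m n : ℕ}

/-- The monomial of the free algebra given by a word. -/
def wordMonomial (K : Type*) [Field K] {m : ℕ} (w : List (Fin m)) : FreeAlgebra K (Fin m) :=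
  (w.map (FreeAlgebra.ι K)).prod

theorem lift_wordMonomial {ι : Type*} [Fintype ι] [DecidableEq ι] (C : Fin m → Matrix ι ι K)
    (w : List (Fin m)) : FreeAlgebra.lift K C (wordMonomial K w) = wordProd C w := by
  rw [wordMonomial, map_list_prod, List.map_map, wordProd]
  congr 2
  funext i
  simp

theorem lift_blockDiag (A B : Fin m → Matrix (Fin n) (Fin n) K) (x : FreeAlgebra K (Fin m)) :
    FreeAlgebra.lift K (blockDiag A B) x =
      Matrix.fromBlocks (evalTuple A x) 0 0 (evalTuple B x) := by
  induction x using FreeAlgebra.induction with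
  | grade0 r =>
    rw [AlgHom.commutes, AlgHom.commutes, AlgHom.commutes]
    simp only [Algebra.algebraMap_eq_smul_one, ← Matrix.fromBlocks_one, Matrix.fromBlocks_smul,
      smul_zero]
  | grade1 i => simp [blockDiag]
  | mul a b ha hb => simp [ha, hb, Matrix.fromBlocks_multiply]
  | add a b ha hb => simp [ha, hb, Matrix.fromBlocks_add]

/-- Lifting the pivot spanning property to the free algebra lets it be transported to tuples in the
closures, which inherit the relations. -/
theorem exists_mem_span_pivots (A B : Fin m → Matrix (Fin n) (Fin n) K)
    (x : FreeAlgebra K (Fin m)) :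
    ∃ y ∈ Submodule.span K (Set.range
      fun w : {w : List (Fin m) // IsPivot (blockDiag A B) w} => wordMonomial K w.1),
      evalTuple A (x - y) = 0 ∧ evalTuple B (x - y) = 0 := by
  have hx : FreeAlgebra.lift K (blockDiag A B) x ∈ genAlgebra (blockDiag A B) := by
    rw [genAlgebra, Algebra.adjoin_range_eq_range_freeAlgebra_lift]
    exact ⟨x, rfl⟩
  have hspan : wordProd (blockDiag A B) '' {u | IsPivot (blockDiag A B) u} =
      (FreeAlgebra.lift K (blockDiag A B)).toLinearMap '' Set.range
        fun w : {w : List (Fin m) // IsPivot (blockDiag A B) w} => wordMonomial K w.1 := by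
    rw [← Set.range_comp, Set.image_eq_range]
    congr 1
    funext w
    exact (lift_wordMonomial _ _).symm
  have hx' := genAlgebra_le_span _ hx
  rw [hspan, ← Submodule.map_span] at hx'
  obtain ⟨y, hy, hyx⟩ := hx'
  refine ⟨y, hy, ?_⟩
  have h0 : FreeAlgebra.lift K (blockDiag A B) (x - y) = 0 := by
    rw [map_sub, sub_eq_zero]
    exact hyx.symm
  rw [lift_blockDiag, ← Matrix.fromBlocks_zero, Matrix.fromBlocks_inj] at h0
  exact ⟨h0.1, h0.2.2.2⟩

theorem coeff_detOneAdd {ι : Type*} [Fintype ι] [DecidableEq ι] (M : Matrix ι ι K) :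
    (detOneAdd M).coeff 0 = 1 ∧ (detOneAdd M).coeff 1 = M.trace := by
  refine ⟨?_, Matrix.coeff_det_one_add_X_smul_one M⟩
  unfold detOneAdd
  rw [Matrix.det_one_add_X_smul]
  simp [pow_two, Polynomial.mul_coeff_zero]

theorem detOneAdd_eq_prod_pow {k : ℕ} {d : Fin k → ℕ} {N : Fin k → ℕ} {M : Matrix (Fin n) (Fin n) K}
    {g : Matrix (Σ x : (Σ i, Fin (N i)), Fin (d x.1)) (Fin n) K}
    {h : Matrix (Fin n) (Σ x : (Σ i, Fin (N i)), Fin (d x.1)) K} (hgh : g * h = 1) (hhg : h * g = 1)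
    (z : ∀ i, Matrix (Fin (d i)) (Fin (d i)) K)
    (hM : g * M * h = Matrix.blockDiagonal' fun x : (Σ i, Fin (N i)) => z x.1) :
    detOneAdd M = ∏ i, detOneAdd (z i) ^ N i := by
  rw [← detOneAdd_conj M hgh hhg, hM, detOneAdd_blockDiagonal, Fintype.prod_sigma]
  exact Finset.prod_congr rfl fun i _ =>
    Fin.prod_const (N i) (detOneAdd (z i))

/-- Two representations of a product of matrix algebras are isomorphic if the polynomials
`det (1 + t z)` agree for all `z` in a spanning set. -/
theorem exists_conj_of_detOneAdd_eq {k : ℕ} {d : Fin k → ℕ} [∀ i, NeZero (d i)]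
    (ρ σ : (∀ i, Matrix (Fin (d i)) (Fin (d i)) K) →ₐ[K] Matrix (Fin n) (Fin n) K) {T : Type*}
    (z : T → ∀ i, Matrix (Fin (d i)) (Fin (d i)) K)
    (hz : Submodule.span K (Set.range z) = ⊤)
    (h : ∀ s, detOneAdd (ρ (z s)) = detOneAdd (σ (z s))) :
    ∃ g h : Matrix (Fin n) (Fin n) K, g * h = 1 ∧ ∀ y, σ y = g * ρ y * h := by
  obtain ⟨N, g₁, h₁, hgh₁, hhg₁, hρ⟩ := exists_conj_blockDiagonal ρ
  obtain ⟨N', g₂, h₂, hgh₂, hhg₂, hσ⟩ := exists_conj_blockDiagonal σ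
  obtain rfl : N = N' := by
    refine exponents_eq_of_prod_pow_eq z hz
      (fun i => Matrix.traceLinearMap (Fin (d i)) K K ∘ₗ LinearMap.proj i)
      -- `E_00` has trace `1` in any characteristic, so these elements are dual to the factor
      -- traces.
      (fun i => ⟨piSingle K i 0 0, ?_, fun j hj => ?_⟩) (fun s i => detOneAdd (z s i))
      (fun s i => (coeff_detOneAdd _).1) (fun s i => (coeff_detOneAdd _).2) N N' fun s => ?_
    · simp [piSingle]
    · simp [piSingle, hj]
    · rw [← detOneAdd_eq_prod_pow hgh₁ hhg₁ _ (hρ _), ← detOneAdd_eq_prod_pow hgh₂ hhg₂ _ (hσ _), h]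
  refine ⟨h₂ * g₁, h₁ * g₂, ?_, fun y => ?_⟩
  · calc h₂ * g₁ * (h₁ * g₂) = h₂ * (g₁ * h₁) * g₂ := by simp only [Matrix.mul_assoc]
      _ = 1 := by rw [hgh₁, Matrix.mul_one, hhg₂]
  · calc σ y = (h₂ * g₂) * σ y * (h₂ * g₂) := by rw [hhg₂, one_mul, mul_one]
      _ = h₂ * (g₂ * σ y * h₂) * g₂ := by simp only [Matrix.mul_assoc]
      _ = h₂ * (g₁ * ρ y * h₁) * g₂ := by rw [hσ, hρ]
      _ = _ := by simp only [Matrix.mul_assoc]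

theorem closureEquiv_of_detOneAddT_eq [IsAlgClosed K] (A B : Fin m → Matrix (Fin n) (Fin n) K)
    (h : ∀ w, IsPivot (blockDiag A B) w →
      detOneAddT (wordProd A w) = detOneAddT (wordProd B w)) : ClosureEquiv A B := by
  obtain ⟨D, hD, E, hE, hss⟩ := exists_semisimple_degeneration A B
  obtain ⟨k, d, hd, ⟨Φ⟩⟩ :=
    IsSemisimpleRing.exists_algEquiv_pi_matrix_of_isAlgClosed K (evalPair D E).range
  let π : FreeAlgebra K (Fin m) →ₐ[K] _ := Φ.toAlgHom.comp (evalPair D E).rangeRestrict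
  let ρ := ((AlgHom.fst K (Matrix (Fin n) (Fin n) K) (Matrix (Fin n) (Fin n) K)).comp
    (evalPair D E).range.val).comp Φ.symm.toAlgHom
  let σ := ((AlgHom.snd K (Matrix (Fin n) (Fin n) K) (Matrix (Fin n) (Fin n) K)).comp
    (evalPair D E).range.val).comp Φ.symm.toAlgHom
  have hρ : ∀ x, ρ (π x) = evalTuple D x := fun x => by simp [ρ, π]
  have hσ : ∀ x, σ (π x) = evalTuple E x := fun x => by simp [σ, π]
  have hspan : Submodule.span K (Set.range
      fun w : {w : List (Fin m) // IsPivot (blockDiag A B) w} => π (wordMonomial K w.1)) = ⊤ := by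
    rw [eq_top_iff]
    rintro r -
    obtain ⟨⟨_, x, rfl⟩, rfl⟩ := Φ.surjective r
    obtain ⟨y, hy, hAy, hBy⟩ := exists_mem_span_pivots A B x
    -- The relation `x - y` holds at `A` and `B`, hence at `D` and `E`.
    have hxy : π x = π y := by
      refine congrArg Φ (Subtype.ext ?_)
      have h1 := evalTuple_eq_zero_of_mem_closure hD hAy
      have h2 := evalTuple_eq_zero_of_mem_closure hE hBy
      rw [map_sub, sub_eq_zero] at h1 h2
      exact Prod.ext h1 h2
    change π x ∈ _
    rw [hxy]
    have := Submodule.mem_map_of_mem (f := π.toLinearMap) hy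
    rw [Submodule.map_span, ← Set.range_comp] at this
    exact this
  obtain ⟨g, g', hgg, hconj⟩ := exists_conj_of_detOneAdd_eq ρ σ _ hspan fun w => by
    rw [hρ, hσ, detOneAdd_eq_detOneAddT, detOneAdd_eq_detOneAddT,
      detOneAddT_evalTuple_of_mem_closure hD, detOneAddT_evalTuple_of_mem_closure hE,
      lift_wordMonomial, lift_wordMonomial, h _ w.2]
  refine ⟨E, ?_, hE⟩
  have hED : E = fun i => g * D i * g' := by
    funext i
    have := hconj (π (FreeAlgebra.ι K i))
    rw [hρ, hσ] at this
    simpa using this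
  rw [hED]
  exact conj_mem_zariskiClosure hD hgg

theorem detOneAddT_wordProd_of_closureEquiv {A B : Fin m → Matrix (Fin n) (Fin n) K}
    (h : ClosureEquiv A B) (w : List (Fin m)) :
    detOneAddT (wordProd A w) = detOneAddT (wordProd B w) := by
  obtain ⟨D, hA, hB⟩ := h
  rw [← lift_wordMonomial, ← lift_wordMonomial, ← detOneAddT_evalTuple_of_mem_closure hA,
    ← detOneAddT_evalTuple_of_mem_closure hB]

end Main

end MatrixInvariants

end

theorem theorem5p2 {K : Type*} [Field K] [IsAlgClosed K] (m n : ℕ)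
    (A B : Fin m → Matrix (Fin n) (Fin n) K) :
    MatrixInvariants.ClosureEquiv A B ↔
      ∀ j : {w : List (Fin m) // MatrixInvariants.IsPivot (MatrixInvariants.blockDiag A B) w},
        MatrixInvariants.detOneAddT
            (MatrixInvariants.pivotBasis (MatrixInvariants.blockDiag A B) j :
              Matrix (Fin n ⊕ Fin n) (Fin n ⊕ Fin n) K).toBlocks₁₁ =
          MatrixInvariants.detOneAddT
            (MatrixInvariants.pivotBasis (MatrixInvariants.blockDiag A B) j :
              Matrix (Fin n ⊕ Fin n) (Fin n ⊕ Fin n) K).toBlocks₂₂ := by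
  simp only [MatrixInvariants.coe_pivotBasis, MatrixInvariants.wordProd_blockDiag,
    Matrix.toBlocks_fromBlocks₁₁, Matrix.toBlocks_fromBlocks₂₂]
  exact ⟨fun h j => MatrixInvariants.detOneAddT_wordProd_of_closureEquiv h j.1,
    fun h => MatrixInvariants.closureEquiv_of_detOneAddT_eq A B fun w hw => h ⟨w, hw⟩⟩
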